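/- **Setting.** For every $n\ge 1$ let $D_n=\operatorname{diag}(\lambda_{n,0},\dots,\lambda_{n,n-1})$ be a real diagonal matrix, let $X_n=n^{-1/2}(x^n_{i,j})_{0\le i,j<n}$ be a random Hermitian matrix, let $\varepsilon=\varepsilon_n>0$ and put $D_n^\varepsilon=D_n+\varepsilon X_n$. Let $(\mathbf u_j^\varepsilon)_j$ be an orthonormal basis of eigenvectors of $D_n^\varepsilon$, with eigenvalues $(\lambda_j^\varepsilon)_j$ repeated according to multiplicity, and let $(\mathbf e_i)_{0\le i<n}$ be the canonical basis of $\mathbb C^n$. For $x\in[0,1]$ put $[x]_n=\min(\lfloor nx\rfloor,\,n-1)$. Assume: (a) for each $n$ the entries $x^n_{i,j}$, $i\le j$, are independent and centered, with variance $\sigma_n^2(i,j)=\mathbb E|x^n_{i,j}|^2$, and $\mathbb E|x^n_{i,j}|^6$ is bounded uniformly in $n,i,j$; (b) there are bounded real functions $f$ on $[0,1]$ and $\sigma$ on $[0,1]^2$ such that $$\eta_n=\sup_{x\in[0,1]}|\lambda_{n,[x]_n}-f(x)|+\sup_{(x,y)\in[0,1]^2}|\sigma_n^2([x]_n,[y]_n)-\sigma^2(x,y)|\longrightarrow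 0;$$ (c) the push-forward $\mu_f$ of the uniform measure on $[0,1]$ by $f$ has a density $\rho$ with respect to the Lebesgue measure and a compact support; (d) there is a symmetric function $\tau$ on $\mathbb R^2$ with $\sigma^2(x,y)=\tau(f(x),f(y))$ for all $x\neq y$ in $[0,1]$. **Theorem.** Let $\alpha_n>0$ with $\alpha_n\to0$ and $\max\{n^{1/2}\varepsilon_n,\eta_n,n^{-1/2}\}/\alpha_n^8\to0$. Let $x,x_0\in[0,1]$ with $f(x)\ne f(x_0)$, and suppose that $\rho(f(x))>0$ and $$\lim_{r\to0^+}\frac{\mu_f\big((f(x)-r,\,f(x)+r)\big)}{2r}=\rho(f(x)).$$ Then, in probability as $n\to\infty$, $$\frac{n\,\varepsilon_n^{-2}}{\operatorname{Card}\{j:|\lambda_j^\varepsilon-f(x)|<\alpha_n\}}\sum_{j:\,|\lambda_j^\varepsilon-f(x)|<\alpha_n}\big|\langle \mathbf u_j^\varepsilon,\mathbf e_{[x_0]_n}\rangle\big|^2\ \longrightarrow\ \frac{\tau(f(x_0),f(x))}{(f(x)-f(x_0))^2}.$$ (The quotient is read as $0$ if the window contains no eigenvalue.) -/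

import Mathlib

open MeasureTheory ProbabilityTheory Filter Topology

/-- The row of an `n × n` matrix (rows numbered `0, …, n - 1`) that belongs to the point
`x ∈ [0, 1]`: row `⌊n x⌋`, where the single point `x = 1` is put into the last row. -/
noncomputable def cell (n : ℕ+) (x : ℝ) : Fin n :=
  ⟨min ⌊(n : ℝ) * x⌋₊ ((n : ℕ) - 1), by have := n.pos; omega⟩

/-- The variance `𝔼 |X - 𝔼 X|²` of a complex random variable. -/
noncomputable def complexVariance {Ω : Type*} [MeasurableSpace Ω] (P : Measure Ω)
    (X : Ω → ℂ) : ℝ :=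
  ∫ ω, ‖X ω - ∫ ω', X ω' ∂P‖ ^ 2 ∂P

/-- The error `η_n` made by replacing the diagonal entries `lam i` and the variances `v i j`
of size `n` by the profiles `f` on `[0, 1]` and `σ²` on `[0, 1]²`, in the supremum norm. -/
noncomputable def profileError (n : ℕ+) (lam : Fin n → ℝ) (v : Fin n → Fin n → ℝ)
    (f : ℝ → ℝ) (σ : ℝ → ℝ → ℝ) : ℝ :=
  (⨆ x : Set.Icc (0 : ℝ) 1, |lam (cell n x) - f x|) +
    ⨆ p : Set.Icc (0 : ℝ) 1 × Set.Icc (0 : ℝ) 1,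
      |v (cell n p.1) (cell n p.2) - σ p.1 p.2 ^ 2|

/-- The push-forward by `f` of the uniform measure on `[0, 1]`. -/
noncomputable def profileLaw (f : ℝ → ℝ) : Measure ℝ :=
  (volume.restrict (Set.Icc (0 : ℝ) 1)).map f

/-- The matrix `D + ε X` with `D = diag lam` and `X = n^{-1/2} (x i j)`. -/
noncomputable def perturbedMatrix (n : ℕ+) (lam : Fin n → ℝ) (ε : ℝ)
    (x : Fin n → Fin n → ℂ) : Matrix (Fin n) (Fin n) ℂ :=
  Matrix.diagonal (fun i => (lam i : ℂ)) +
    (ε : ℂ) • (((Real.sqrt n)⁻¹ : ℝ) : ℂ) • Matrix.of x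

/-- `u` is an orthonormal basis of eigenvectors of `A`, with (real) eigenvalues `μ`, repeated
according to multiplicity. -/
def IsEigenbasis {n : ℕ+} (A : Matrix (Fin n) (Fin n) ℂ)
    (u : OrthonormalBasis (Fin n) ℂ (EuclideanSpace ℂ (Fin n))) (μ : Fin n → ℝ) : Prop :=
  ∀ j, Matrix.toEuclideanLin A (u j) = (μ j : ℂ) • u j

open Classical in
/-- The indices of the eigenvalues at distance less than `α` from `c`. -/
noncomputable def window {n : ℕ+} (μ : Fin n → ℝ) (c α : ℝ) : Finset (Fin n) :=
  Finset.univ.filter fun j => |μ j - c| < α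

/-- `n ε⁻²` times the average, over the eigenvalues at distance less than `α` from `c`, of
`|⟨u_j, e_i⟩|²`. -/
noncomputable def averagedOverlap {n : ℕ+}
    (u : OrthonormalBasis (Fin n) ℂ (EuclideanSpace ℂ (Fin n))) (μ : Fin n → ℝ)
    (ε c α : ℝ) (i : Fin n) : ℝ :=
  ((n : ℝ) * (ε ^ 2)⁻¹) / ((window μ c α).card : ℝ) *
    ∑ j ∈ window μ c α, ‖inner ℂ (u j) (EuclideanSpace.single i (1 : ℂ))‖ ^ 2

/-! Write `i = cell n y₀` and let `x_i` be the `i`-th column of the noise. Pairing the eigenvector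
equation with `e_i` gives `(μ_j - λ_i) ⟨u_j, e_i⟩ = ε n^{-1/2} ⟨u_j, x_i⟩`
(`IsEigenbasis.sub_mul_inner_single`). For eigenvalues in the window, `(μ_j - λ_i)²` tends to `(f y
- f y₀)² ≠ 0`, so it remains to average `|⟨u_j, x_i⟩|²` over the window.

The `u_j` depend on `x_i`, so the spectral projection of the perturbed matrix is first replaced by
that of the deterministic `D`. Indicators are sandwiched between trapezoids, and the quadratic form
of a Lipschitz function moves by at most its Lipschitz constant times the Hilbert-Schmidt norm of `ε
X`, which is of order `√n ε` (`abs_sum_mul_norm_inner_sq_sub_le`). For `D` the sum becomes `∑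
|x_{k,i}|²` over the `k` with `λ_k` near `f y`. Its terms are independent, so it concentrates at its
mean (`tendsto_probFilter_sum_norm_sq_div`), and each term has mean close to `τ (f y₀) (f y)`
(`tendsto_sum_window_div`). Either window holds about `2 n α ρ (f y)` eigenvalues
(`tendsto_card_window_div`, `card_window_le`).

Continuity of `τ` is not needed: uniform approximation on the grids of all sizes forces `f` and `σ²
(·, y₀)` to be continuous (`continuousOn_of_abs_cell_sub_le`), and compactness does the rest
(`exists_radius_of_continuousOn`). -/

/-- The filter on `ℕ+ × Ω` of the events that hold with probability tending to one. -/
def probFilter {Ω : Type*} [MeasurableSpace Ω] (P : Measure Ω) : Filter (ℕ+ × Ω) where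
  sets := {S | Tendsto (fun n => P {ω | (n, ω) ∉ S}) atTop (𝓝 0)}
  univ_sets := by simp
  sets_of_superset := by
    intro S T hS hST
    exact tendsto_of_tendsto_of_tendsto_of_le_of_le tendsto_const_nhds hS (fun _ => zero_le)
      (fun n => measure_mono fun ω hω h => hω (hST h))
  inter_sets := by
    intro S T hS hT
    have h := Tendsto.add hS hT
    rw [add_zero] at h
    refine tendsto_of_tendsto_of_tendsto_of_le_of_le tendsto_const_nhds h (fun _ => zero_le)
      (fun n => ?_)
    refine (measure_mono fun ω hω => ?_).trans (measure_union_le _ _)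
    by_contra hc
    simp only [Set.mem_union, Set.mem_ofPred_eq, not_or, not_not] at hc
    exact hω hc

/-! ### Convergence in probability as convergence along a filter -/

section ProbFilter

variable {Ω : Type*} [MeasurableSpace Ω] {P : Measure Ω}

lemma eventually_probFilter {p : ℕ+ × Ω → Prop} :
    (∀ᶠ z in probFilter P, p z) ↔ Tendsto (fun n => P {ω | ¬ p (n, ω)}) atTop (𝓝 0) :=
  Iff.rfl

lemma tendsto_fst_probFilter : Tendsto Prod.fst (probFilter P) atTop := by
  intro s hs
  rw [mem_map]
  change Tendsto (fun n => P {ω | (n, ω) ∉ Prod.fst ⁻¹' s}) atTop (𝓝 0)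
  refine tendsto_const_nhds.congr' ?_
  filter_upwards [hs] with n hn
  simp [hn]

/-- This lets limits in probability be added, divided and squeezed as ordinary limits. Measurability
of `F` is not required, which matters because the eigenbasis is an arbitrary function of `ω`. -/
lemma tendstoInMeasure_of_tendsto_probFilter {F : ℕ+ → Ω → ℝ} {a : ℝ}
    (h : Tendsto (fun z : ℕ+ × Ω => F z.1 z.2) (probFilter P) (𝓝 a)) :
    TendstoInMeasure P F atTop (fun _ => a) := by
  intro δ hδ
  have := (EMetric.tendsto_nhds.1 h) δ hδ
  rw [eventually_probFilter] at this
  simpa using this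

/-- Markov's inequality. -/
lemma tendsto_probFilter_of_integral [IsFiniteMeasure P] {F : ℕ+ → Ω → ℝ} {b : ℕ+ → ℝ}
    (hF : ∀ n ω, 0 ≤ F n ω) (hint : ∀ n, Integrable (F n) P)
    (hb : ∀ᶠ n in atTop, ∫ ω, F n ω ∂P ≤ b n) (hb0 : Tendsto b atTop (𝓝 0)) :
    Tendsto (fun z : ℕ+ × Ω => F z.1 z.2) (probFilter P) (𝓝 0) := by
  rw [Metric.tendsto_nhds]
  intro δ hδ
  rw [eventually_probFilter]
  have hlim : Tendsto (fun n => ENNReal.ofReal (b n / δ)) atTop (𝓝 0) := by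
    have := ENNReal.tendsto_ofReal (hb0.div_const δ)
    simpa using this
  refine tendsto_of_tendsto_of_tendsto_of_le_of_le' tendsto_const_nhds hlim
    (Eventually.of_forall fun _ => zero_le) ?_
  filter_upwards [hb] with n hn
  have hm := mul_meas_ge_le_integral_of_nonneg (Eventually.of_forall (hF n)) (hint n) δ
  have hset : {ω | ¬ dist (F n ω) 0 < δ} = {ω | δ ≤ F n ω} := by
    ext ω
    simp [abs_of_nonneg (hF n ω)]
  rw [hset, ← ofReal_measureReal]
  refine ENNReal.ofReal_le_ofReal ?_
  rw [le_div_iff₀ hδ]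
  linarith

end ProbFilter

/-! ### Lipschitz functions of two operators -/

section Spectral

variable {ι κ E : Type*} [Fintype ι] [Fintype κ] [NormedAddCommGroup E] [InnerProductSpace ℂ E]

/-- Parseval in `w` inserts a second basis, so that forms diagonal in `u` and in `w` can be
subtracted term by term. -/
lemma sum_mul_norm_inner_sq_eq (u : OrthonormalBasis ι ℂ E) (w : OrthonormalBasis κ ℂ E)
    (a : ι → ℝ) (v : E) :
    ((∑ j, a j * ‖inner ℂ (u j) v‖ ^ 2 : ℝ) : ℂ) =
      ∑ j, ∑ k, (a j : ℂ) * (inner ℂ v (u j) * inner ℂ (u j) (w k) * inner ℂ (w k) v) := by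
  push_cast
  refine Finset.sum_congr rfl fun j _ => ?_
  rw [← Finset.mul_sum]
  congr 1
  simp_rw [mul_assoc]
  rw [← Finset.mul_sum, w.sum_inner_mul_inner, ← inner_conj_symm v (u j)]
  exact (RCLike.conj_mul _).symm

/-- Quadratic forms of a Lipschitz function of two operators that are diagonal in the bases `u`
and `w` differ by at most the Lipschitz constant times the Hilbert-Schmidt distance of the
operators. -/
lemma abs_sum_mul_norm_inner_sq_sub_le (u : OrthonormalBasis ι ℂ E) (w : OrthonormalBasis κ ℂ E)
    (μ : ι → ℝ) (ν : κ → ℝ) {F K : ℝ} (hF : 0 ≤ F) (hK : 0 ≤ K)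
    (hHS : ∑ j, ∑ k, (μ j - ν k) ^ 2 * ‖inner ℂ (u j) (w k)‖ ^ 2 ≤ F ^ 2)
    {g : ℝ → ℝ} (hg : ∀ s t, |g s - g t| ≤ K * |s - t|) (v : E) :
    |∑ j, g (μ j) * ‖inner ℂ (u j) v‖ ^ 2 - ∑ k, g (ν k) * ‖inner ℂ (w k) v‖ ^ 2| ≤
      K * F * ‖v‖ ^ 2 := by
  have hdiff : ((∑ j, g (μ j) * ‖inner ℂ (u j) v‖ ^ 2 -
      ∑ k, g (ν k) * ‖inner ℂ (w k) v‖ ^ 2 : ℝ) : ℂ) =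
      ∑ p : ι × κ, ((g (μ p.1) - g (ν p.2) : ℝ) : ℂ) *
        (inner ℂ v (u p.1) * inner ℂ (u p.1) (w p.2) * inner ℂ (w p.2) v) := by
    have h2 : ((∑ k, g (ν k) * ‖inner ℂ (w k) v‖ ^ 2 : ℝ) : ℂ) =
        ∑ j, ∑ k, (g (ν k) : ℂ) *
          (inner ℂ v (u j) * inner ℂ (u j) (w k) * inner ℂ (w k) v) := by
      -- The expansion with the bases exchanged has conjugate triple products; its sum is real, so
      -- conjugating restores those of the first expansion.
      have := congrArg (starRingEnd ℂ) (sum_mul_norm_inner_sq_eq w u (fun k => g (ν k)) v)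
      rw [Complex.conj_ofReal] at this
      rw [this, map_sum, Finset.sum_comm]
      refine Finset.sum_congr rfl fun k _ => ?_
      rw [map_sum]
      refine Finset.sum_congr rfl fun j _ => ?_
      simp only [map_mul, inner_conj_symm, Complex.conj_ofReal]
      ring
    rw [Complex.ofReal_sub, sum_mul_norm_inner_sq_eq u w (fun j => g (μ j)), h2,
      Fintype.sum_prod_type, ← Finset.sum_sub_distrib]
    refine Finset.sum_congr rfl fun j _ => ?_
    rw [← Finset.sum_sub_distrib]
    refine Finset.sum_congr rfl fun k _ => ?_
    push_cast
    ring
  have hbound : |∑ j, g (μ j) * ‖inner ℂ (u j) v‖ ^ 2 - ∑ k, g (ν k) * ‖inner ℂ (w k) v‖ ^ 2| ≤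
      ∑ p : ι × κ, (K * (|μ p.1 - ν p.2| * ‖inner ℂ (u p.1) (w p.2)‖)) *
        (‖inner ℂ (u p.1) v‖ * ‖inner ℂ (w p.2) v‖) := by
    rw [← Real.norm_eq_abs, ← Complex.norm_real, hdiff]
    refine (norm_sum_le _ _).trans (Finset.sum_le_sum fun p _ => ?_)
    rw [norm_mul, norm_mul, norm_mul, Complex.norm_real, Real.norm_eq_abs,
      norm_inner_symm v (u p.1)]
    have := mul_le_mul_of_nonneg_right (hg (μ p.1) (ν p.2))
      (show 0 ≤ ‖inner ℂ (u p.1) v‖ * ‖inner ℂ (u p.1) (w p.2)‖ * ‖inner ℂ (w p.2) v‖ by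
        positivity)
    refine this.trans (le_of_eq ?_)
    ring
  -- Cauchy-Schwarz over pairs: the overlap `⟨u_j, w_k⟩` stays with the eigenvalue difference to
  -- form the Hilbert-Schmidt distance, and Parseval in both bases handles the other factor.
  have hcs := Finset.sum_mul_sq_le_sq_mul_sq (Finset.univ : Finset (ι × κ))
    (fun p => K * (|μ p.1 - ν p.2| * ‖inner ℂ (u p.1) (w p.2)‖))
    (fun p => ‖inner ℂ (u p.1) v‖ * ‖inner ℂ (w p.2) v‖)
  have h1 : ∑ p : ι × κ, (K * (|μ p.1 - ν p.2| * ‖inner ℂ (u p.1) (w p.2)‖)) ^ 2 ≤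
      (K * F) ^ 2 := by
    simp_rw [mul_pow, sq_abs]
    rw [← Finset.mul_sum, Fintype.sum_prod_type]
    exact mul_le_mul_of_nonneg_left hHS (sq_nonneg K)
  have h2 : ∑ p : ι × κ, (‖inner ℂ (u p.1) v‖ * ‖inner ℂ (w p.2) v‖) ^ 2 = (‖v‖ ^ 2) ^ 2 := by
    simp_rw [mul_pow]
    rw [Fintype.sum_prod_type]
    simp_rw [← Finset.mul_sum]
    rw [← Finset.sum_mul, u.sum_sq_norm_inner_right, w.sum_sq_norm_inner_right]
    ring
  refine hbound.trans (abs_le_of_sq_le_sq' ?_ (by positivity)).2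
  rw [h2] at hcs
  rw [mul_pow _ (‖v‖ ^ 2)]
  exact hcs.trans (mul_le_mul_of_nonneg_right h1 (by positivity))

/-- A trapezoidal function between the indicators of two concentric intervals. -/
lemma exists_lipschitz_between (c : ℝ) {r s : ℝ} (hrs : r < s) :
    ∃ g : ℝ → ℝ, (∀ a b, |g a - g b| ≤ (s - r)⁻¹ * |a - b|) ∧ (∀ t, 0 ≤ g t) ∧
      (∀ t, g t ≤ 1) ∧ (∀ t, |t - c| < r → g t = 1) ∧ ∀ t, ¬ |t - c| < s → g t = 0 := by
  have h0 : 0 < s - r := sub_pos.2 hrs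
  refine ⟨fun t => max 0 (min 1 ((s - r)⁻¹ * (s - |t - c|))), fun a b => ?_,
    fun t => le_max_left _ _, fun t => max_le zero_le_one (min_le_left _ _), fun t ht => ?_,
    fun t ht => ?_⟩
  · have h1 : ∀ p q : ℝ, |max 0 (min 1 p) - max 0 (min 1 q)| ≤ |p - q| := by
      intro p q
      grind
    refine (h1 _ _).trans ?_
    rw [← mul_sub, abs_mul, abs_of_pos (inv_pos.2 h0)]
    refine mul_le_mul_of_nonneg_left ?_ (inv_pos.2 h0).le
    have := abs_abs_sub_abs_le_abs_sub (b - c) (a - c)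
    rw [show s - |a - c| - (s - |b - c|) = |b - c| - |a - c| by ring, abs_sub_comm a b]
    simpa using this
  · have : 1 ≤ (s - r)⁻¹ * (s - |t - c|) := by
      rw [inv_mul_eq_div, le_div_iff₀ h0]
      linarith
    simp only [min_eq_left this, max_eq_right zero_le_one]
  · have : (s - r)⁻¹ * (s - |t - c|) ≤ 0 :=
      mul_nonpos_of_nonneg_of_nonpos (inv_pos.2 h0).le (by linarith)
    exact max_eq_left ((min_le_right _ _).trans this)

end Spectral

/-! ### Comparing spectral windows of two operators -/

section Windows

variable {n : ℕ+} {u w : OrthonormalBasis (Fin n) ℂ (EuclideanSpace ℂ (Fin n))} {μ ν : Fin n → ℝ}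
  {F : ℝ}

/-- A trapezoid equal to `1` within `r` and `0` beyond `s` dominates one indicator, is dominated by
the other, and has Lipschitz constant `(s - r)⁻¹`. -/
lemma sum_window_norm_inner_sq_le (hF : 0 ≤ F)
    (hHS : ∑ j, ∑ k, (μ j - ν k) ^ 2 * ‖inner ℂ (u j) (w k)‖ ^ 2 ≤ F ^ 2)
    (c : ℝ) {r s : ℝ} (hrs : r < s) (v : EuclideanSpace ℂ (Fin n)) :
    ∑ j ∈ window μ c r, ‖inner ℂ (u j) v‖ ^ 2 ≤
      ∑ k ∈ window ν c s, ‖inner ℂ (w k) v‖ ^ 2 + (s - r)⁻¹ * F * ‖v‖ ^ 2 := by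
  obtain ⟨g, hg, hg0, hg1, hgr, hgs⟩ := exists_lipschitz_between c hrs
  have h := abs_sum_mul_norm_inner_sq_sub_le u w μ ν hF (inv_pos.2 (sub_pos.2 hrs)).le hHS hg v
  have h1 : ∑ j ∈ window μ c r, ‖inner ℂ (u j) v‖ ^ 2 ≤ ∑ j, g (μ j) * ‖inner ℂ (u j) v‖ ^ 2 := by
    rw [window, Finset.sum_filter]
    refine Finset.sum_le_sum fun j _ => ?_
    split_ifs with hj
    · rw [hgr _ hj, one_mul]
    · exact mul_nonneg (hg0 _) (sq_nonneg _)
  have h2 : ∑ k, g (ν k) * ‖inner ℂ (w k) v‖ ^ 2 ≤ ∑ k ∈ window ν c s, ‖inner ℂ (w k) v‖ ^ 2 := by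
    rw [window, Finset.sum_filter]
    refine Finset.sum_le_sum fun k _ => ?_
    split_ifs with hk
    · exact mul_le_of_le_one_left (sq_nonneg _) (hg1 _)
    · rw [hgs _ hk, zero_mul]
  linarith [(abs_le.1 h).2]

lemma card_window_le (hF : 0 ≤ F)
    (hHS : ∑ j, ∑ k, (μ j - ν k) ^ 2 * ‖inner ℂ (u j) (w k)‖ ^ 2 ≤ F ^ 2)
    (c : ℝ) {r s : ℝ} (hrs : r < s) :
    ((window μ c r).card : ℝ) ≤ (window ν c s).card + n * ((s - r)⁻¹ * F) := by
  have hcard : ∀ (b : OrthonormalBasis (Fin n) ℂ (EuclideanSpace ℂ (Fin n))) (W : Finset (Fin n)),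
      ∑ i, ∑ j ∈ W, ‖inner ℂ (b j) (w i)‖ ^ 2 = W.card := by
    intro b W
    rw [Finset.sum_comm]
    simp [w.sum_sq_norm_inner_left]
  -- Summing over the orthonormal vectors `v = w i` takes the trace of both projections.
  have h := Finset.sum_le_sum fun i (_ : i ∈ Finset.univ) =>
    sum_window_norm_inner_sq_le hF hHS c hrs (w i)
  rw [hcard, Finset.sum_add_distrib, hcard] at h
  simpa using h

lemma sum_sq_mul_norm_inner_sq_symm :
    ∑ k, ∑ j, (ν k - μ j) ^ 2 * ‖inner ℂ (w k) (u j)‖ ^ 2 =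
      ∑ j, ∑ k, (μ j - ν k) ^ 2 * ‖inner ℂ (u j) (w k)‖ ^ 2 := by
  rw [Finset.sum_comm]
  refine Finset.sum_congr rfl fun j _ => Finset.sum_congr rfl fun k _ => ?_
  rw [norm_inner_symm, ← neg_sub, neg_sq]

end Windows

/-! ### The eigenvector equation in coordinates -/

section Perturbation

variable {n : ℕ+} {lam : Fin n → ℝ} {ε : ℝ} {x : Fin n → Fin n → ℂ}
  {u : OrthonormalBasis (Fin n) ℂ (EuclideanSpace ℂ (Fin n))} {μ : Fin n → ℝ}

lemma perturbedMatrix_isHermitian (hx : ∀ i j, x j i = starRingEnd ℂ (x i j)) :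
    (perturbedMatrix n lam ε x).IsHermitian := by
  ext i j
  have h := hx i j
  by_cases hij : i = j
  · subst hij
    simp [perturbedMatrix, ← h]
  · simp [perturbedMatrix, hij, Ne.symm hij, h]

/-- Hermitian symmetry moves the matrix onto `e_k`, which it maps to `λ_k e_k` plus the scaled noise
column. -/
lemma IsEigenbasis.sub_mul_inner_single (hx : ∀ i j, x j i = starRingEnd ℂ (x i j))
    (hu : IsEigenbasis (perturbedMatrix n lam ε x) u μ) (j k : Fin n) :
    ((μ j - lam k : ℝ) : ℂ) * inner ℂ (u j) (EuclideanSpace.single k (1 : ℂ)) =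
      ((ε * (Real.sqrt n)⁻¹ : ℝ) : ℂ) * inner ℂ (u j) (WithLp.toLp 2 fun l => x l k) := by
  have hsymm := (Matrix.isSymmetric_toEuclideanLin_iff.2
    (perturbedMatrix_isHermitian (lam := lam) (ε := ε) hx)) (u j) (EuclideanSpace.single k (1 : ℂ))
  have hcol : Matrix.toEuclideanLin (perturbedMatrix n lam ε x) (EuclideanSpace.single k (1 : ℂ)) =
      (lam k : ℂ) • EuclideanSpace.single k (1 : ℂ) +
        ((ε * (Real.sqrt n)⁻¹ : ℝ) : ℂ) • WithLp.toLp 2 fun l => x l k := by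
    ext l
    by_cases hl : l = k
    · subst hl
      simp [perturbedMatrix, Matrix.toLpLin_apply, mul_assoc]
    · simp [perturbedMatrix, Matrix.toLpLin_apply, mul_assoc, hl]
  rw [hu j, hcol, inner_smul_left, inner_add_right, inner_smul_right, inner_smul_right,
    Complex.conj_ofReal] at hsymm
  rw [Complex.ofReal_sub, sub_mul, hsymm]
  ring

lemma IsEigenbasis.sub_sq_mul_norm_inner_sq (hx : ∀ i j, x j i = starRingEnd ℂ (x i j))
    (hu : IsEigenbasis (perturbedMatrix n lam ε x) u μ) (j k : Fin n) :
    (μ j - lam k) ^ 2 * ‖inner ℂ (u j) (EuclideanSpace.single k (1 : ℂ))‖ ^ 2 =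
      ε ^ 2 / n * ‖inner ℂ (u j) (WithLp.toLp 2 fun l => x l k)‖ ^ 2 := by
  have h := congrArg (fun z => ‖z‖ ^ 2) (hu.sub_mul_inner_single hx j k)
  simp only [norm_mul, mul_pow, Complex.norm_real, Real.norm_eq_abs, sq_abs, inv_pow] at h
  rw [h, Real.sq_sqrt (Nat.cast_nonneg _), div_eq_mul_inv]

lemma norm_inner_basisFun_toLp (k : Fin n) (v : Fin n → ℂ) :
    ‖inner ℂ (EuclideanSpace.basisFun (Fin n) ℂ k) (WithLp.toLp 2 v)‖ = ‖v k‖ := by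
  simp [EuclideanSpace.inner_single_left]

lemma norm_sq_toLp (k : Fin n) :
    ‖(WithLp.toLp 2 fun l => x l k : EuclideanSpace ℂ (Fin n))‖ ^ 2 = ∑ l, ‖x l k‖ ^ 2 := by
  rw [EuclideanSpace.norm_sq_eq]

/-- Both sides are the squared Hilbert-Schmidt norm of `ε X`; this feeds the hypothesis `hHS` of the
window lemmas. -/
lemma IsEigenbasis.sum_sub_sq_mul_norm_inner_sq (hx : ∀ i j, x j i = starRingEnd ℂ (x i j))
    (hu : IsEigenbasis (perturbedMatrix n lam ε x) u μ) :
    ∑ j, ∑ k, (μ j - lam k) ^ 2 *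
        ‖inner ℂ (u j) (EuclideanSpace.basisFun (Fin n) ℂ k)‖ ^ 2 =
      ε ^ 2 / n * ∑ k, ∑ l, ‖x l k‖ ^ 2 := by
  rw [Finset.sum_comm, Finset.mul_sum]
  refine Finset.sum_congr rfl fun k _ => ?_
  simp_rw [EuclideanSpace.basisFun_apply, hu.sub_sq_mul_norm_inner_sq hx]
  rw [← Finset.mul_sum, u.sum_sq_norm_inner_right, norm_sq_toLp]

end Perturbation

/-! ### The regular grid and continuity of the profiles -/

section Cells

lemma cell_eq_of_mem_Ico {n : ℕ+} {k : Fin n} {t : ℝ}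
    (ht : t ∈ Set.Ico ((k : ℝ) / n) (((k : ℝ) + 1) / n)) : cell n t = k := by
  have hn : (0 : ℝ) < n := Nat.cast_pos.2 n.pos
  have h1 := (div_le_iff₀ hn).1 ht.1
  have h2 := (lt_div_iff₀ hn).1 ht.2
  have hfl : ⌊(n : ℝ) * t⌋₊ = k :=
    (Nat.floor_eq_iff (by linarith [Nat.cast_nonneg (α := ℝ) (k : ℕ)])).2
      ⟨by linarith, by linarith⟩
  ext
  have := k.isLt
  simp only [cell, hfl]
  omega

/-- The interval is closed on the right because `t = 1` is put into the last row. -/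
lemma mem_Icc_of_cell {n : ℕ+} {t : ℝ} (ht : t ∈ Set.Icc (0 : ℝ) 1) :
    t ∈ Set.Icc ((cell n t : ℝ) / n) (((cell n t : ℝ) + 1) / n) := by
  have hn : (0 : ℝ) < n := Nat.cast_pos.2 n.pos
  have hnt : 0 ≤ (n : ℝ) * t := mul_nonneg hn.le ht.1
  have h1 := Nat.floor_le hnt
  have h2 := Nat.lt_floor_add_one ((n : ℝ) * t)
  have hv : ((cell n t : ℕ)) = min ⌊(n : ℝ) * t⌋₊ ((n : ℕ) - 1) := rfl
  constructor
  · rw [div_le_iff₀ hn]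
    have : ((cell n t : ℕ) : ℝ) ≤ ⌊(n : ℝ) * t⌋₊ := by
      rw [hv]
      exact_mod_cast min_le_left _ _
    linarith
  · rw [le_div_iff₀ hn]
    rcases le_total ⌊(n : ℝ) * t⌋₊ ((n : ℕ) - 1) with h | h
    · rw [hv, min_eq_left h]
      linarith
    · rw [hv, min_eq_right h]
      have hcast : (((n : ℕ) - 1 : ℕ) : ℝ) + 1 = n := by
        have := n.pos
        exact_mod_cast Nat.sub_add_cancel this
      rw [hcast]
      nlinarith [ht.2]

lemma div_mem_Icc {n : ℕ+} (k : Fin n) : (k : ℝ) / n ∈ Set.Icc (0 : ℝ) 1 := by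
  have hn : (0 : ℝ) < n := Nat.cast_pos.2 n.pos
  refine ⟨by positivity, (div_le_one hn).2 ?_⟩
  exact_mod_cast k.isLt.le

lemma cell_div {n : ℕ+} (k : Fin n) : cell n ((k : ℝ) / n) = k := by
  have hn : (0 : ℝ) < n := Nat.cast_pos.2 n.pos
  exact cell_eq_of_mem_Ico ⟨le_rfl, by gcongr; linarith⟩

lemma Ico_subset_Icc_zero_one {n : ℕ+} (k : Fin n) :
    Set.Ico ((k : ℝ) / n) (((k : ℝ) + 1) / n) ⊆ Set.Icc 0 1 := by
  have hn : (0 : ℝ) < n := Nat.cast_pos.2 n.pos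
  intro t ht
  refine ⟨(div_mem_Icc k).1.trans ht.1, ht.2.le.trans ((div_le_one hn).2 ?_)⟩
  exact_mod_cast k.isLt

/-- The half-open cells of `W` are disjoint, have length `1 / n` and lie in `T`. -/
lemma card_div_le_volume_real {n : ℕ+} {W : Finset (Fin n)} {T : Set ℝ}
    (hT : T ⊆ Set.Icc 0 1) (h : ∀ t ∈ Set.Icc (0 : ℝ) 1, cell n t ∈ W → t ∈ T) :
    (W.card : ℝ) ≤ n * volume.real T := by
  have hn : (0 : ℝ) < n := Nat.cast_pos.2 n.pos
  have hdisj : (W : Set (Fin n)).PairwiseDisjoint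
      fun k => Set.Ico ((k : ℝ) / n) (((k : ℝ) + 1) / n) := by
    intro k _ l _ hkl
    refine Set.disjoint_left.2 fun t hk hl => hkl ?_
    rw [← cell_eq_of_mem_Ico hk, cell_eq_of_mem_Ico hl]
  have hsub : (⋃ k ∈ W, Set.Ico ((k : ℝ) / n) (((k : ℝ) + 1) / n)) ⊆ T := by
    refine Set.iUnion₂_subset fun k hk t ht => h t (Ico_subset_Icc_zero_one k ht) ?_
    rwa [cell_eq_of_mem_Ico ht]
  have hvol : ∀ k : Fin n, volume.real (Set.Ico ((k : ℝ) / n) (((k : ℝ) + 1) / n)) = 1 / n := by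
    intro k
    rw [Real.volume_real_Ico_of_le (by gcongr; linarith)]
    ring
  have hle : volume.real (⋃ k ∈ W, Set.Ico ((k : ℝ) / n) (((k : ℝ) + 1) / n)) ≤ volume.real T :=
    measureReal_mono hsub
      (((measure_mono hT).trans_lt (by simp [Real.volume_Icc])).ne)
  rw [measureReal_biUnion_finset hdisj (fun _ _ => measurableSet_Ico)
    (fun k _ => by simp [Real.volume_Ico])] at hle
  simp_rw [hvol] at hle
  rw [Finset.sum_const, nsmul_eq_mul, mul_one_div, div_le_iff₀ hn] at hle
  linarith

/-- The closed cells of `W` cover `T`, so subadditivity suffices. -/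
lemma volume_real_le_card_div {n : ℕ+} {W : Finset (Fin n)} {T : Set ℝ}
    (hT : T ⊆ Set.Icc 0 1) (h : ∀ t ∈ T, cell n t ∈ W) :
    n * volume.real T ≤ W.card := by
  have hn : (0 : ℝ) < n := Nat.cast_pos.2 n.pos
  have hsub : T ⊆ ⋃ k ∈ W, Set.Icc ((k : ℝ) / n) (((k : ℝ) + 1) / n) := fun t ht =>
    Set.mem_iUnion₂.2 ⟨cell n t, h t ht, mem_Icc_of_cell (hT ht)⟩
  have hvol : ∀ k : Fin n, volume.real (Set.Icc ((k : ℝ) / n) (((k : ℝ) + 1) / n)) = 1 / n := by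
    intro k
    rw [Real.volume_real_Icc_of_le (by gcongr; linarith)]
    ring
  have hfin : volume (⋃ k ∈ W, Set.Icc ((k : ℝ) / n) (((k : ℝ) + 1) / n)) ≠ ⊤ :=
    (measure_biUnion_lt_top W.finite_toSet (fun k _ => by simp [Real.volume_Icc])).ne
  have hle := (measureReal_mono hsub hfin).trans (measureReal_biUnion_finset_le W _)
  simp_rw [hvol] at hle
  rw [Finset.sum_const, nsmul_eq_mul, mul_one_div, le_div_iff₀ hn] at hle
  linarith

/-- The floor is locally constant off the grid; at `0` only right neighbours count, and at `1` the
truncation in `cell` absorbs the jump. -/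
lemma eventually_cell_eq {n : ℕ+} {t : ℝ} (ht : t ∈ Set.Icc (0 : ℝ) 1)
    (h : t = 0 ∨ t = 1 ∨ ∀ m : ℕ, (n : ℝ) * t ≠ m) :
    ∀ᶠ s in 𝓝[Set.Icc 0 1] t, cell n s = cell n t := by
  have hn : (0 : ℝ) < n := Nat.cast_pos.2 n.pos
  have hcont : Tendsto (fun s : ℝ => (n : ℝ) * s) (𝓝[Set.Icc 0 1] t) (𝓝 ((n : ℝ) * t)) :=
    ((continuous_const.mul continuous_id).tendsto t).mono_left nhdsWithin_le_nhds
  rcases h with rfl | rfl | h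
  · filter_upwards [hcont.eventually (gt_mem_nhds (show (n : ℝ) * 0 < 1 by simp)),
      self_mem_nhdsWithin] with s hs _
    have : ⌊(n : ℝ) * s⌋₊ = 0 := Nat.floor_eq_zero.2 hs
    ext
    simp [cell, this]
  · filter_upwards [hcont.eventually (lt_mem_nhds (show (n : ℝ) - 1 < n * 1 by linarith)),
      self_mem_nhdsWithin] with s hs _
    have hcast : (((n : ℕ) - 1 : ℕ) : ℝ) = n - 1 := by
      rw [Nat.cast_sub n.pos, Nat.cast_one]
    have h1 : (n : ℕ) - 1 ≤ ⌊(n : ℝ) * s⌋₊ := Nat.le_floor (by rw [hcast]; exact hs.le)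
    ext
    simp only [cell, mul_one, Nat.floor_natCast]
    omega
  · have h0 : 0 ≤ (n : ℝ) * t := mul_nonneg hn.le ht.1
    have h1 : (⌊(n : ℝ) * t⌋₊ : ℝ) < n * t := lt_of_le_of_ne (Nat.floor_le h0) (h _).symm
    have h2 := Nat.lt_floor_add_one ((n : ℝ) * t)
    filter_upwards [hcont.eventually (lt_mem_nhds h1), hcont.eventually (gt_mem_nhds h2)]
      with s hs1 hs2
    have : ⌊(n : ℝ) * s⌋₊ = ⌊(n : ℝ) * t⌋₊ :=
      (Nat.floor_eq_iff ((Nat.cast_nonneg _).trans hs1.le)).2 ⟨hs1.le, hs2⟩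
    simp only [cell, this]

/-- A uniform limit of step functions on the regular grids of all sizes is continuous. -/
lemma continuousOn_of_abs_cell_sub_le {g : ℝ → ℝ} {a : ∀ n : ℕ+, Fin n → ℝ} {e : ℕ+ → ℝ}
    (he : Tendsto e atTop (𝓝 0))
    (h : ∀ n, ∀ t ∈ Set.Icc (0 : ℝ) 1, |a n (cell n t) - g t| ≤ e n) :
    ContinuousOn g (Set.Icc 0 1) := by
  intro t ht
  rw [ContinuousWithinAt, Metric.tendsto_nhds]
  intro δ hδ
  obtain ⟨N, hN⟩ := eventually_atTop.1 (he.eventually (gt_mem_nhds (half_pos hδ)))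
  -- One of `N`, `N + 1` works: if `N t` and `(N + 1) t` were both integers, their difference `t`
  -- would be an integer in `(0, 1)`.
  obtain ⟨n, hNn, hn⟩ : ∃ n : ℕ+, N ≤ n ∧ (t = 0 ∨ t = 1 ∨ ∀ m : ℕ, (n : ℝ) * t ≠ m) := by
    by_contra! hc
    obtain ⟨ht0, ht1, m, hm⟩ := hc N le_rfl
    obtain ⟨_, _, m', hm'⟩ := hc (N + 1) (PNat.lt_add_right N 1).le
    rw [PNat.add_coe, Nat.cast_add, PNat.one_coe, Nat.cast_one] at hm'
    have hlt0 : 0 < t := lt_of_le_of_ne ht.1 (Ne.symm ht0)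
    have hlt1 : t < 1 := lt_of_le_of_ne ht.2 ht1
    have h1 : (m : ℝ) < m' := by linarith
    have h2 : (m' : ℝ) < m + 1 := by linarith
    have h3 : m < m' := by exact_mod_cast h1
    have h4 : m' < m + 1 := by exact_mod_cast h2
    omega
  filter_upwards [eventually_cell_eq ht hn, self_mem_nhdsWithin] with s hs hs1
  have h1 := h n s hs1
  have h2 := h n t ht
  rw [hs] at h1
  rw [Real.dist_eq]
  have h3 := hN n hNn
  rw [abs_le] at h1 h2
  rw [abs_lt]
  constructor <;> linarith

/-- On the compact set where `|h - a| ≥ δ`, the continuous function `|f - c|` has no zero, hence a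
positive lower bound. -/
lemma exists_radius_of_continuousOn {f h : ℝ → ℝ} {c a δ : ℝ}
    (hf : ContinuousOn f (Set.Icc 0 1)) (hh : ContinuousOn h (Set.Icc 0 1))
    (hc : ∀ t ∈ Set.Icc (0 : ℝ) 1, f t = c → h t = a) (hδ : 0 < δ) :
    ∃ r > 0, ∀ t ∈ Set.Icc (0 : ℝ) 1, |f t - c| < r → |h t - a| < δ := by
  have hK : IsCompact (Set.Icc (0 : ℝ) 1 ∩ (fun t => |h t - a|) ⁻¹' Set.Ici δ) :=
    isCompact_Icc.of_isClosed_subset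
      ((hh.sub continuousOn_const).abs.preimage_isClosed_of_isClosed isClosed_Icc isClosed_Ici)
      Set.inter_subset_left
  obtain ⟨r, hr, hmin⟩ := hK.exists_forall_le' (f := fun t => |f t - c|) (a := 0)
    ((hf.sub continuousOn_const).abs.mono Set.inter_subset_left) (by
      rintro t ⟨ht, htδ⟩
      refine abs_pos.2 fun h0 => ?_
      have : h t - a = 0 := sub_eq_zero.2 (hc t ht (sub_eq_zero.1 h0))
      simp only [Set.mem_preimage, this, abs_zero, Set.mem_Ici] at htδ
      linarith)
  refine ⟨r, hr, fun t ht htr => ?_⟩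
  by_contra hcon
  exact absurd (hmin t ⟨ht, not_lt.1 hcon⟩) (not_le.2 htr)

end Cells

/-! ### Counting diagonal entries through the law of `f` -/

section Counting

variable {f : ℝ → ℝ}

lemma profileLaw_real_Ioo (hf : ContinuousOn f (Set.Icc 0 1)) (c r : ℝ) :
    (profileLaw f).real (Set.Ioo (c - r) (c + r)) =
      volume.real {t | t ∈ Set.Icc (0 : ℝ) 1 ∧ |f t - c| < r} := by
  rw [profileLaw, measureReal_def, Measure.map_apply_of_aemeasurable
    (hf.aemeasurable measurableSet_Icc) measurableSet_Ioo,
    Measure.restrict_apply' measurableSet_Icc, measureReal_def]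
  congr 2
  ext t
  simp only [Set.mem_inter_iff, Set.mem_preimage, Set.mem_Ioo, Set.mem_ofPred_eq, abs_lt]
  constructor
  · rintro ⟨⟨h1, h2⟩, h3⟩
    exact ⟨h3, by linarith, by linarith⟩
  · rintro ⟨h3, h1, h2⟩
    exact ⟨⟨by linarith, by linarith⟩, h3⟩

lemma card_window_le_profileLaw (hf : ContinuousOn f (Set.Icc 0 1)) {n : ℕ+} {lam : Fin n → ℝ}
    {e : ℝ} (h : ∀ t ∈ Set.Icc (0 : ℝ) 1, |lam (cell n t) - f t| ≤ e) (c r : ℝ) :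
    ((window lam c r).card : ℝ) ≤
      n * (profileLaw f).real (Set.Ioo (c - (r + e)) (c + (r + e))) := by
  rw [profileLaw_real_Ioo hf]
  refine card_div_le_volume_real (fun t ht => ht.1) fun t ht hw => ⟨ht, ?_⟩
  have h1 := h t ht
  have h2 : |lam (cell n t) - c| < r := by simpa [window] using hw
  rw [abs_le] at h1
  rw [abs_lt] at h2 ⊢
  constructor <;> linarith

lemma profileLaw_le_card_window (hf : ContinuousOn f (Set.Icc 0 1)) {n : ℕ+} {lam : Fin n → ℝ}
    {e : ℝ} (h : ∀ t ∈ Set.Icc (0 : ℝ) 1, |lam (cell n t) - f t| ≤ e) (c r : ℝ) :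
    n * (profileLaw f).real (Set.Ioo (c - (r - e)) (c + (r - e))) ≤ (window lam c r).card := by
  rw [profileLaw_real_Ioo hf]
  refine volume_real_le_card_div (fun t ht => ht.1) fun t ht => ?_
  have h1 := h t ht.1
  have h2 := ht.2
  suffices |lam (cell n t) - c| < r by simpa [window] using this
  rw [abs_le] at h1
  rw [abs_lt] at h2 ⊢
  constructor <;> linarith

/-- The number of diagonal entries in a shrinking window is governed by the density. -/
lemma tendsto_card_window_div (hf : ContinuousOn f (Set.Icc 0 1)) {lam : ∀ n : ℕ+, Fin n → ℝ}
    {e α s : ℕ+ → ℝ} {c d : ℝ}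
    (h : ∀ n, ∀ t ∈ Set.Icc (0 : ℝ) 1, |lam n (cell n t) - f t| ≤ e n)
    (hα : ∀ n, 0 < α n) (hα0 : Tendsto α atTop (𝓝 0))
    (he : Tendsto (fun n => e n / α n) atTop (𝓝 0))
    (hs : Tendsto (fun n => s n / α n) atTop (𝓝 1))
    (hd : Tendsto (fun r : ℝ => (profileLaw f).real (Set.Ioo (c - r) (c + r)) / (2 * r))
      (𝓝[>] 0) (𝓝 d)) :
    Tendsto (fun n => ((window (lam n) c (s n)).card : ℝ) / (2 * n * α n)) atTop (𝓝 d) := by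
  -- The quotient factors as the density quotient at radius `r n` times `r n / α n`.
  have key : ∀ r : ℕ+ → ℝ, Tendsto (fun n => r n / α n) atTop (𝓝 1) →
      Tendsto (fun n : ℕ+ => (n * (profileLaw f).real (Set.Ioo (c - r n) (c + r n))) /
        (2 * n * α n)) atTop (𝓝 d) := by
    intro r hr
    have hpos : ∀ᶠ n in atTop, 0 < r n := by
      filter_upwards [hr.eventually (lt_mem_nhds one_pos)] with n hn
      have := mul_pos hn (hα n)
      rwa [div_mul_cancel₀ _ (hα n).ne'] at this
    have hr0 : Tendsto r atTop (𝓝[>] 0) := by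
      refine tendsto_nhdsWithin_iff.2 ⟨?_, hpos⟩
      have := hr.mul hα0
      rw [mul_zero] at this
      exact this.congr fun n => div_mul_cancel₀ _ (hα n).ne'
    have := (hd.comp hr0).mul hr
    rw [mul_one] at this
    refine this.congr' ?_
    filter_upwards [hpos] with n hn
    have h1 := (hα n).ne'
    have h2 := hn.ne'
    have h3 : (n : ℝ) ≠ 0 := Nat.cast_ne_zero.2 n.ne_zero
    simp only [Function.comp]
    field_simp
  -- Since `e = o(α)`, shifting the radius by `e` does not change the limit.
  have hlow := key (fun n => s n - e n) (by simpa [sub_div] using hs.sub he)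
  have hup := key (fun n => s n + e n) (by simpa [add_div] using hs.add he)
  refine tendsto_of_tendsto_of_tendsto_of_le_of_le hlow hup (fun n => ?_) fun n => ?_
  · have := hα n
    exact div_le_div_of_nonneg_right (profileLaw_le_card_window hf (h n) c (s n)) (by positivity)
  · have := hα n
    exact div_le_div_of_nonneg_right (card_window_le_profileLaw hf (h n) c (s n)) (by positivity)

end Counting

/-! ### Moment and variance bounds -/

section Moments

variable {Ω : Type*} [MeasurableSpace Ω] {P : Measure Ω}

lemma integrable_norm_pow_and_integral_le [IsProbabilityMeasure P] {X : Ω → ℂ} {C : NNReal} (hX : Measurable X)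
    (hC : ∫⁻ ω, ‖X ω‖ₑ ^ 6 ∂P ≤ C) {k : ℕ} (hk : k ≤ 6) :
    Integrable (fun ω => ‖X ω‖ ^ k) P ∧ ∫ ω, ‖X ω‖ ^ k ∂P ≤ 1 + C := by
  have hE : ∀ ω, ‖‖X ω‖ ^ 6‖ₑ = ‖X ω‖ₑ ^ 6 := fun ω => by rw [enorm_pow, enorm_norm]
  have h6 : Integrable (fun ω => ‖X ω‖ ^ 6) P := by
    refine ⟨(hX.norm.pow_const 6).aestronglyMeasurable, ?_⟩
    rw [HasFiniteIntegral]
    simp_rw [hE]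
    exact hC.trans_lt ENNReal.coe_lt_top
  have hI : ∫ ω, ‖X ω‖ ^ 6 ∂P ≤ C := by
    rw [integral_eq_lintegral_of_nonneg_ae (Eventually.of_forall fun ω => by positivity) h6.1]
    refine ENNReal.toReal_le_of_le_ofReal C.coe_nonneg ?_
    rw [ENNReal.ofReal_coe_nnreal]
    refine le_trans (le_of_eq (lintegral_congr fun ω => ?_)) hC
    rw [← hE, Real.enorm_eq_ofReal (by positivity)]
  have hle : ∀ ω, ‖X ω‖ ^ k ≤ 1 + ‖X ω‖ ^ 6 := by
    intro ω
    rcases le_total ‖X ω‖ 1 with h | h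
    · exact (pow_le_one₀ (norm_nonneg _) h).trans (le_add_of_nonneg_right (by positivity))
    · exact (pow_le_pow_right₀ h hk).trans (le_add_of_nonneg_left zero_le_one)
  have hint : Integrable (fun ω => 1 + ‖X ω‖ ^ 6) P := (integrable_const _).add h6
  have hk' : Integrable (fun ω => ‖X ω‖ ^ k) P := by
    refine hint.mono' (hX.norm.pow_const k).aestronglyMeasurable (Eventually.of_forall fun ω => ?_)
    rw [Real.norm_of_nonneg (by positivity)]
    exact hle ω
  refine ⟨hk', (integral_mono hk' hint hle).trans ?_⟩
  rw [integral_add (integrable_const _) h6]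
  simpa using hI

variable {n : ℕ+} {x : Fin n → Fin n → Ω → ℂ} {C : NNReal}

/-- Each entry of a column is, up to conjugation, an upper-triangular entry, different rows use
different ones, and the modulus ignores conjugation. -/
lemma iIndepFun_norm_sq_column (hherm : ∀ i j ω, x j i ω = starRingEnd ℂ (x i j ω))
    (hindep : iIndepFun (fun p : {p : Fin n × Fin n // p.1 ≤ p.2} => x p.1.1 p.1.2) P)
    (i : Fin n) : iIndepFun (fun k ω => ‖x k i ω‖ ^ 2) P := by
  let p : Fin n → {p : Fin n × Fin n // p.1 ≤ p.2} := fun k =>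
    if h : k ≤ i then ⟨(k, i), h⟩ else ⟨(i, k), (not_le.1 h).le⟩
  have hp : Function.Injective p := by
    intro k l hkl
    by_cases hk : k ≤ i <;> by_cases hl : l ≤ i <;>
      simp only [p, hk, hl, dite_true, dite_false, Subtype.mk.injEq, Prod.mk.injEq] at hkl
    · exact hkl.1
    · exact absurd hkl.2.symm.le hl
    · exact absurd hkl.2.le hk
    · exact hkl.2
  have h := (hindep.precomp hp).comp (fun _ z => ‖z‖ ^ 2) (fun _ => by fun_prop)
  convert h using 1
  ext k ω
  by_cases hk : k ≤ i
  · simp [p, hk]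
  · simp [p, hk, hherm i k ω]

/-- Variances of independent terms add, and each is at most a fourth moment. -/
lemma integral_sq_sum_norm_sq_sub_le [IsProbabilityMeasure P]
    (hmeas : ∀ i j, Measurable (x i j))
    (hherm : ∀ i j ω, x j i ω = starRingEnd ℂ (x i j ω))
    (hindep : iIndepFun (fun p : {p : Fin n × Fin n // p.1 ≤ p.2} => x p.1.1 p.1.2) P)
    (hC : ∀ i j, ∫⁻ ω, ‖x i j ω‖ₑ ^ 6 ∂P ≤ C) (i : Fin n) (W : Finset (Fin n)) :
    Integrable (fun ω => (∑ k ∈ W, ‖x k i ω‖ ^ 2 - ∑ k ∈ W, ∫ ω', ‖x k i ω'‖ ^ 2 ∂P) ^ 2) P ∧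
    ∫ ω, (∑ k ∈ W, ‖x k i ω‖ ^ 2 - ∑ k ∈ W, ∫ ω', ‖x k i ω'‖ ^ 2 ∂P) ^ 2 ∂P ≤
      n * (1 + C) := by
  have h4 := fun k => integrable_norm_pow_and_integral_le (hmeas k i) (hC k i) (k := 4) (by norm_num)
  have h2 := fun k => integrable_norm_pow_and_integral_le (hmeas k i) (hC k i) (k := 2) (by norm_num)
  have hL2 : ∀ k, MemLp (fun ω => ‖x k i ω‖ ^ 2) 2 P := by
    intro k
    rw [memLp_two_iff_integrable_sq ((hmeas k i).norm.pow_const 2).aestronglyMeasurable]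
    simpa only [← pow_mul] using (h4 k).1
  have hsum : MemLp (fun ω => ∑ k ∈ W, ‖x k i ω‖ ^ 2) 2 P := memLp_finsetSum W fun k _ => hL2 k
  have hmean : ∫ ω, ∑ k ∈ W, ‖x k i ω‖ ^ 2 ∂P = ∑ k ∈ W, ∫ ω', ‖x k i ω'‖ ^ 2 ∂P :=
    integral_finsetSum W fun k _ => (h2 k).1
  refine ⟨(hsum.sub (memLp_const _)).integrable_sq, ?_⟩
  have hvar := IndepFun.variance_sum (μ := P) (s := W) (X := fun k ω => ‖x k i ω‖ ^ 2)
    (fun k _ => hL2 k)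
    (fun k _ l _ hkl => (iIndepFun_norm_sq_column hherm hindep i).indepFun hkl)
  have hfun : (∑ k ∈ W, fun ω => ‖x k i ω‖ ^ 2) = fun ω => ∑ k ∈ W, ‖x k i ω‖ ^ 2 := by
    ext ω
    simp
  rw [hfun, variance_eq_integral hsum.1.aemeasurable, hmean] at hvar
  rw [hvar]
  have hvk : ∀ k, Var[fun ω => ‖x k i ω‖ ^ 2; P] ≤ 1 + C := by
    intro k
    refine (variance_le_expectation_sq (hL2 k).1).trans ?_
    refine le_trans (le_of_eq (integral_congr_ae (Eventually.of_forall fun ω => ?_))) (h4 k).2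
    simp [← pow_mul]
  refine (Finset.sum_le_card_nsmul W _ _ fun k _ => hvk k).trans ?_
  rw [nsmul_eq_mul]
  have hcard : (W.card : ℝ) ≤ n := by
    have := W.card_le_univ
    rw [Fintype.card_fin] at this
    exact_mod_cast this
  exact mul_le_mul_of_nonneg_right hcard (by positivity)

end Moments

/-! ### Pointwise bounds from the profile error -/

section ProfileError

/-- Boundedness of the profiles is essential: a real supremum over an unbounded set has the default
value `0` and would bound nothing. -/
lemma abs_le_profileError {n : ℕ+} {lam : Fin n → ℝ} {v : Fin n → Fin n → ℝ} {f : ℝ → ℝ}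
    {σ : ℝ → ℝ → ℝ} (hf : ∃ B : ℝ, ∀ y ∈ Set.Icc (0 : ℝ) 1, |f y| ≤ B)
    (hσ : ∃ B : ℝ, ∀ y ∈ Set.Icc (0 : ℝ) 1, ∀ z ∈ Set.Icc (0 : ℝ) 1, |σ y z| ≤ B) :
    (∀ t ∈ Set.Icc (0 : ℝ) 1, |lam (cell n t) - f t| ≤ profileError n lam v f σ) ∧
    ∀ s ∈ Set.Icc (0 : ℝ) 1, ∀ t ∈ Set.Icc (0 : ℝ) 1,
      |v (cell n s) (cell n t) - σ s t ^ 2| ≤ profileError n lam v f σ := by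
  obtain ⟨B, hB⟩ := hf
  obtain ⟨B', hB'⟩ := hσ
  have hbdd1 : BddAbove (Set.range fun t : Set.Icc (0 : ℝ) 1 => |lam (cell n t) - f t|) := by
    refine ⟨∑ k, |lam k| + B, ?_⟩
    rintro _ ⟨t, rfl⟩
    refine (abs_sub _ _).trans (add_le_add ?_ (hB t t.2))
    exact Finset.single_le_sum (f := fun k => |lam k|) (fun _ _ => abs_nonneg _)
      (Finset.mem_univ _)
  have hbdd2 : BddAbove (Set.range fun p : Set.Icc (0 : ℝ) 1 × Set.Icc (0 : ℝ) 1 =>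
      |v (cell n p.1) (cell n p.2) - σ p.1 p.2 ^ 2|) := by
    refine ⟨∑ q : Fin n × Fin n, |v q.1 q.2| + B' ^ 2, ?_⟩
    rintro _ ⟨p, rfl⟩
    refine (abs_sub _ _).trans (add_le_add ?_ ?_)
    · exact Finset.single_le_sum (f := fun q : Fin n × Fin n => |v q.1 q.2|)
        (fun _ _ => abs_nonneg _) (Finset.mem_univ (cell n p.1, cell n p.2))
    · rw [abs_pow]
      exact pow_le_pow_left₀ (abs_nonneg _) (hB' _ p.1.2 _ p.2.2) 2
  have h1 : 0 ≤ ⨆ t : Set.Icc (0 : ℝ) 1, |lam (cell n t) - f t| :=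
    Real.iSup_nonneg fun _ => abs_nonneg _
  have h2 : 0 ≤ ⨆ p : Set.Icc (0 : ℝ) 1 × Set.Icc (0 : ℝ) 1,
      |v (cell n p.1) (cell n p.2) - σ p.1 p.2 ^ 2| :=
    Real.iSup_nonneg fun _ => abs_nonneg _
  refine ⟨fun t ht => ?_, fun s hs t ht => ?_⟩
  · exact (le_ciSup hbdd1 ⟨t, ht⟩).trans (le_add_of_nonneg_right h2)
  · exact (le_ciSup hbdd2 (⟨s, hs⟩, ⟨t, ht⟩)).trans (le_add_of_nonneg_left h1)

end ProfileError

/-! ### Limits over windows of the diagonal matrix -/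

section DiagonalWindows

/-- Sums over shrinking windows of quantities that are asymptotically constant there. -/
lemma tendsto_sum_window_div {lam : ∀ n : ℕ+, Fin n → ℝ} {m : ∀ n : ℕ+, Fin n → ℝ}
    {f h : ℝ → ℝ} {e α s : ℕ+ → ℝ} {c a d : ℝ} (hd : 0 < d)
    (hf : ContinuousOn f (Set.Icc 0 1)) (hh : ContinuousOn h (Set.Icc 0 1))
    (hc : ∀ t ∈ Set.Icc (0 : ℝ) 1, f t = c → h t = a)
    (hlam : ∀ n, ∀ t ∈ Set.Icc (0 : ℝ) 1, |lam n (cell n t) - f t| ≤ e n)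
    (hm : ∀ n, ∀ t ∈ Set.Icc (0 : ℝ) 1, |m n (cell n t) - h t| ≤ e n)
    (he : Tendsto e atTop (𝓝 0)) (hs : Tendsto s atTop (𝓝 0)) (hα : ∀ n, 0 < α n)
    (hcard : Tendsto (fun n => ((window (lam n) c (s n)).card : ℝ) / (2 * n * α n))
      atTop (𝓝 d)) :
    Tendsto (fun n => (∑ k ∈ window (lam n) c (s n), m n k) / (2 * n * α n))
      atTop (𝓝 (d * a)) := by
  suffices hdiff : Tendsto (fun n => (∑ k ∈ window (lam n) c (s n), m n k) / (2 * n * α n) -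
      ((window (lam n) c (s n)).card : ℝ) / (2 * n * α n) * a) atTop (𝓝 0) by
    simpa using hdiff.add (hcard.mul_const a)
  rw [Metric.tendsto_nhds]
  intro δ hδ
  -- One half is spent on the variation of `h`, the other on `e`; the normalized count is eventually
  -- below `d + 1`.
  have hδ' : 0 < δ / (d + 1) / 2 := by positivity
  obtain ⟨r, hr, hrh⟩ := exists_radius_of_continuousOn hf hh hc hδ'
  have hse : Tendsto (fun n => s n + e n) atTop (𝓝 0) := by simpa using hs.add he
  filter_upwards [hse.eventually (gt_mem_nhds hr), he.eventually (gt_mem_nhds hδ'),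
    hcard.eventually (gt_mem_nhds (lt_add_one d))] with n hn1 hn2 hn3
  have hT : 0 < 2 * (n : ℝ) * α n := by
    have := hα n
    have : (0 : ℝ) < n := Nat.cast_pos.2 n.pos
    positivity
  have hk : ∀ k ∈ window (lam n) c (s n), |m n k - a| ≤ δ / (d + 1) := by
    intro k hk
    have hk' : |lam n k - c| < s n := by simpa [window] using hk
    have h1 := hlam n _ (div_mem_Icc k)
    have h2 := hm n _ (div_mem_Icc k)
    rw [cell_div] at h1 h2
    have h3 := hrh ((k : ℝ) / n) (div_mem_Icc k) (by
      rw [abs_le] at h1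
      rw [abs_lt] at hk' ⊢
      constructor <;> linarith)
    rw [abs_le] at h2 ⊢
    rw [abs_lt] at h3
    constructor <;> linarith
  have hsum : |∑ k ∈ window (lam n) c (s n), m n k - (window (lam n) c (s n)).card * a| ≤
      (window (lam n) c (s n)).card * (δ / (d + 1)) := by
    rw [← nsmul_eq_mul, ← Finset.sum_const, ← Finset.sum_sub_distrib, ← nsmul_eq_mul]
    exact (Finset.abs_sum_le_sum_abs _ _).trans (Finset.sum_le_card_nsmul _ _ _ hk)
  rw [Real.dist_0_eq_abs, div_mul_eq_mul_div, ← sub_div, abs_div, abs_of_pos hT]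
  refine (div_le_div_of_nonneg_right hsum hT.le).trans_lt ?_
  rw [mul_div_right_comm]
  calc _ < (d + 1) * (δ / (d + 1)) := mul_lt_mul_of_pos_right hn3 (by positivity)
    _ = δ := by field_simp

variable {Ω : Type*} [MeasurableSpace Ω] {P : Measure Ω} [IsProbabilityMeasure P]
  {x : ∀ n : ℕ+, Fin n → Fin n → Ω → ℂ} {C : NNReal} {α : ℕ+ → ℝ}

/-- The weak law of large numbers for the squared entries of one column. -/
lemma tendsto_probFilter_sum_norm_sq_div (hmeas : ∀ n i j, Measurable (x n i j))
    (hherm : ∀ n i j ω, x n j i ω = starRingEnd ℂ (x n i j ω))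
    (hindep : ∀ n : ℕ+,
      iIndepFun (fun p : {p : Fin n × Fin n // p.1 ≤ p.2} => x n p.1.1 p.1.2) P)
    (hC : ∀ n i j, ∫⁻ ω, ‖x n i j ω‖ₑ ^ 6 ∂P ≤ C)
    (hα : Tendsto (fun n : ℕ+ => (Real.sqrt n)⁻¹ / α n) atTop (𝓝 0))
    (i : ∀ n : ℕ+, Fin n) (W : ∀ n : ℕ+, Finset (Fin n)) {a : ℝ}
    (hlim : Tendsto (fun n => (∑ k ∈ W n, ∫ ω, ‖x n k (i n) ω‖ ^ 2 ∂P) / (2 * n * α n))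
      atTop (𝓝 a)) :
    Tendsto (fun z : ℕ+ × Ω => (∑ k ∈ W z.1, ‖x z.1 k (i z.1) z.2‖ ^ 2) / (2 * z.1 * α z.1))
      (probFilter P) (𝓝 a) := by
  -- Chebyshev: a variance of at most `n (1 + C)` divided by `(2 n α)²` is `(1 + C) / 4 · (n^{-1/2}
  -- / α)²`.
  have hsq := tendsto_probFilter_of_integral (P := P)
    (F := fun n ω => (∑ k ∈ W n, ‖x n k (i n) ω‖ ^ 2 -
      ∑ k ∈ W n, ∫ ω', ‖x n k (i n) ω'‖ ^ 2 ∂P) ^ 2 / (2 * n * α n) ^ 2)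
    (b := fun n => (1 + C) / 4 * ((Real.sqrt n)⁻¹ / α n) ^ 2)
    (fun n ω => by positivity)
    (fun n => (integral_sq_sum_norm_sq_sub_le (hmeas n) (hherm n) (hindep n) (hC n) (i n)
      (W n)).1.div_const _)
    (Eventually.of_forall fun n => by
      rw [integral_div]
      refine (div_le_div_of_nonneg_right (integral_sq_sum_norm_sq_sub_le (hmeas n) (hherm n)
        (hindep n) (hC n) (i n) (W n)).2 (sq_nonneg _)).trans (le_of_eq ?_)
      have hn : (n : ℝ) ≠ 0 := Nat.cast_ne_zero.2 n.ne_zero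
      rw [div_pow, inv_pow, Real.sq_sqrt (Nat.cast_nonneg _)]
      by_cases h0 : α n = 0
      · simp [h0]
      · field_simp
        ring)
    (by simpa using (hα.pow 2).const_mul ((1 + (C : ℝ)) / 4))
  have habs := (Real.continuous_sqrt.tendsto 0).comp hsq
  rw [Real.sqrt_zero] at habs
  have hdiff : Tendsto (fun z : ℕ+ × Ω => (∑ k ∈ W z.1, ‖x z.1 k (i z.1) z.2‖ ^ 2 -
      ∑ k ∈ W z.1, ∫ ω', ‖x z.1 k (i z.1) ω'‖ ^ 2 ∂P) / (2 * z.1 * α z.1))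
      (probFilter P) (𝓝 0) := by
    rw [tendsto_zero_iff_abs_tendsto_zero]
    refine habs.congr fun z => ?_
    simp only [Function.comp, ← div_pow, Real.sqrt_sq_eq_abs]
  have := hdiff.add (hlim.comp tendsto_fst_probFilter)
  rw [zero_add] at this
  refine this.congr fun z => ?_
  simp only [Function.comp, sub_div, sub_add_cancel]

/-- The Hilbert-Schmidt norm of the perturbation. -/
lemma tendsto_probFilter_sum_sum_norm_sq (hmeas : ∀ n i j, Measurable (x n i j))
    (hC : ∀ n i j, ∫⁻ ω, ‖x n i j ω‖ₑ ^ 6 ∂P ≤ C) {ε : ℕ+ → ℝ} (k : ℕ)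
    (hα : Tendsto (fun n : ℕ+ => Real.sqrt n * ε n / α n ^ k) atTop (𝓝 0)) :
    Tendsto (fun z : ℕ+ × Ω => ε z.1 ^ 2 / z.1 * (∑ j, ∑ l, ‖x z.1 l j z.2‖ ^ 2) /
      (α z.1 ^ k) ^ 2) (probFilter P) (𝓝 0) := by
  have h2 := fun n i j =>
    integrable_norm_pow_and_integral_le (hmeas n i j) (hC n i j) (k := 2) (by norm_num)
  refine tendsto_probFilter_of_integral (P := P)
    (F := fun n ω => ε n ^ 2 / n * (∑ j, ∑ l, ‖x n l j ω‖ ^ 2) / (α n ^ k) ^ 2)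
    (b := fun n => (1 + C) * (Real.sqrt n * ε n / α n ^ k) ^ 2)
    (fun n ω => by positivity)
    (fun n => ((integrable_finsetSum _ fun j _ => integrable_finsetSum _ fun l _ =>
      (h2 n l j).1).const_mul _).div_const _)
    (Eventually.of_forall fun n => ?_)
    (by simpa using (hα.pow 2).const_mul (1 + (C : ℝ)))
  rw [integral_div, integral_const_mul, integral_finsetSum _ fun j _ =>
    integrable_finsetSum _ fun l _ => (h2 n l j).1]
  have hle : ∑ j, ∫ ω, ∑ l, ‖x n l j ω‖ ^ 2 ∂P ≤ n * (n * (1 + C)) := by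
    refine (Finset.sum_le_card_nsmul _ _ (n * (1 + C) : ℝ) fun j _ => ?_).trans
      (le_of_eq ?_)
    · rw [integral_finsetSum _ fun l _ => (h2 n l j).1]
      refine (Finset.sum_le_card_nsmul _ _ (1 + C : ℝ) fun l _ => (h2 n l j).2).trans (le_of_eq ?_)
      rw [Finset.card_fin, nsmul_eq_mul]
    · rw [Finset.card_fin, nsmul_eq_mul]
  calc _ ≤ ε n ^ 2 / n * (n * (n * (1 + C))) / (α n ^ k) ^ 2 := by gcongr
    _ = _ := by
      have hn : (n : ℝ) ≠ 0 := Nat.cast_ne_zero.2 n.ne_zero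
      rw [div_pow, mul_pow, Real.sq_sqrt (Nat.cast_nonneg _)]
      field_simp

/-- The squared column norm has mean `O(n)`; the factor `α` is slack that makes `n / α` a bound with
probability tending to one. -/
lemma tendsto_probFilter_sum_norm_sq (hmeas : ∀ n i j, Measurable (x n i j))
    (hC : ∀ n i j, ∫⁻ ω, ‖x n i j ω‖ₑ ^ 6 ∂P ≤ C) (hα0 : ∀ n, 0 < α n)
    (hα : Tendsto α atTop (𝓝 0)) (i : ∀ n : ℕ+, Fin n) :
    Tendsto (fun z : ℕ+ × Ω => α z.1 / z.1 * ∑ l, ‖x z.1 l (i z.1) z.2‖ ^ 2)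
      (probFilter P) (𝓝 0) := by
  have h2 := fun n i j =>
    integrable_norm_pow_and_integral_le (hmeas n i j) (hC n i j) (k := 2) (by norm_num)
  refine tendsto_probFilter_of_integral (P := P)
    (F := fun n ω => α n / n * ∑ l, ‖x n l (i n) ω‖ ^ 2) (b := fun n => α n * (1 + C))
    (fun n ω => by have := hα0 n; positivity)
    (fun n => (integrable_finsetSum _ fun l _ => (h2 n l (i n)).1).const_mul _)
    (Eventually.of_forall fun n => ?_)
    (by simpa using hα.mul_const (1 + (C : ℝ)))
  rw [integral_const_mul, integral_finsetSum _ fun l _ => (h2 n l (i n)).1]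
  have hle : ∑ l, ∫ ω, ‖x n l (i n) ω‖ ^ 2 ∂P ≤ n * (1 + C) := by
    refine (Finset.sum_le_card_nsmul _ _ (1 + C : ℝ) fun l _ => (h2 n l (i n)).2).trans
      (le_of_eq ?_)
    rw [Finset.card_fin, nsmul_eq_mul]
  have := hα0 n
  calc _ ≤ α n / n * (n * (1 + C)) := by gcongr
    _ = _ := by
      have hn : (n : ℝ) ≠ 0 := Nat.cast_ne_zero.2 n.ne_zero
      field_simp

end DiagonalWindows

/-! ### The averaged overlaps -/

theorem theorem3p1
    {Ω : Type*} [MeasurableSpace Ω] (P : Measure Ω) [IsProbabilityMeasure P]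
    -- the data of each size `n`: diagonal entries, random entries, strength of the perturbation
    (lam : ∀ n : ℕ+, Fin n → ℝ)
    (x : ∀ n : ℕ+, Fin n → Fin n → Ω → ℂ)
    (ε : ℕ+ → ℝ) (hε : ∀ n, 0 < ε n)
    -- (a) Hermitian, independent up to symmetry, centered, bounded sixth moments
    (hx_meas : ∀ n i j, Measurable (x n i j))
    (hx_herm : ∀ n i j ω, x n j i ω = starRingEnd ℂ (x n i j ω))
    (hx_indep : ∀ n : ℕ+,
      iIndepFun (fun p : {p : Fin n × Fin n // p.1 ≤ p.2} => x n p.1.1 p.1.2) P)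
    (hx_mean : ∀ n i j, ∫ ω, x n i j ω ∂P = 0)
    (hx_moment : ∃ C : NNReal, ∀ n i j, ∫⁻ ω, ‖x n i j ω‖ₑ ^ 6 ∂P ≤ C)
    -- (b) bounded limiting profiles, and the error bound `η` tending to zero
    (f : ℝ → ℝ) (hf_bdd : ∃ B : ℝ, ∀ y ∈ Set.Icc (0 : ℝ) 1, |f y| ≤ B)
    (σ : ℝ → ℝ → ℝ)
    (hσ_bdd : ∃ B : ℝ, ∀ y ∈ Set.Icc (0 : ℝ) 1, ∀ z ∈ Set.Icc (0 : ℝ) 1, |σ y z| ≤ B)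
    (η : ℕ+ → ℝ)
    (hη : ∀ n, η n =
      profileError n (lam n) (fun i j => complexVariance P (x n i j)) f σ)
    (hη_lim : Tendsto η atTop (𝓝 0))
    -- (c) the law of `f` has a density and a compact support
    (ρ : ℝ → ℝ) (hρ_meas : Measurable ρ) (hρ_nonneg : ∀ t, 0 ≤ ρ t)
    (hρ : profileLaw f = volume.withDensity (fun t => ENNReal.ofReal (ρ t)))
    (hρ_supp : IsCompact (profileLaw f).support)
    -- (d) the variance profile is a symmetric function of the diagonal profile
    (τ : ℝ → ℝ → ℝ) (hτ_symm : ∀ s t, τ s t = τ t s)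
    (hτ : ∀ y ∈ Set.Icc (0 : ℝ) 1, ∀ z ∈ Set.Icc (0 : ℝ) 1, y ≠ z →
      σ y z ^ 2 = τ (f y) (f z))
    -- an eigenvector basis of the perturbed matrix, and its eigenvalues
    (u : ∀ n : ℕ+, Ω → OrthonormalBasis (Fin n) ℂ (EuclideanSpace ℂ (Fin n)))
    (μ : ∀ n : ℕ+, Ω → Fin n → ℝ)
    (hu : ∀ n ω, IsEigenbasis
      (perturbedMatrix n (lam n) (ε n) (fun i j => x n i j ω)) (u n ω) (μ n ω))
    -- the size of the windows
    (α : ℕ+ → ℝ) (hα_pos : ∀ n, 0 < α n) (hα_lim : Tendsto α atTop (𝓝 0))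
    (hα : Tendsto
      (fun n : ℕ+ => max (Real.sqrt n * ε n) (max (η n) (Real.sqrt n)⁻¹) / α n ^ 8)
      atTop (𝓝 0))
    -- the two points
    (y y₀ : ℝ) (hy : y ∈ Set.Icc (0 : ℝ) 1) (hy₀ : y₀ ∈ Set.Icc (0 : ℝ) 1)
    (hne : f y ≠ f y₀)
    -- the law of `f` charges small windows around `f y` like `2 r ρ (f y)`, `ρ (f y) > 0`
    (hρ_pos : 0 < ρ (f y))
    (hρ_lim : Tendsto
      (fun r : ℝ => (profileLaw f).real (Set.Ioo (f y - r) (f y + r)) / (2 * r))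
      (𝓝[>] 0) (𝓝 (ρ (f y)))) :
    TendstoInMeasure P
      (fun (n : ℕ+) ω =>
        averagedOverlap (u n ω) (μ n ω) (ε n) (f y) (α n) (cell n y₀))
      atTop
      (fun _ => τ (f y₀) (f y) / (f y - f y₀) ^ 2) := by
  obtain ⟨C, hC⟩ := hx_moment
  have hpe := fun n => abs_le_profileError (n := n) (lam := lam n)
    (v := fun i j => complexVariance P (x n i j)) hf_bdd hσ_bdd
  have hlam : ∀ n, ∀ t ∈ Set.Icc (0 : ℝ) 1, |lam n (cell n t) - f t| ≤ η n := fun n => by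
    rw [hη n]
    exact (hpe n).1
  have hvar : ∀ n, ∀ t ∈ Set.Icc (0 : ℝ) 1,
      |∫ ω, ‖x n (cell n t) (cell n y₀) ω‖ ^ 2 ∂P - σ t y₀ ^ 2| ≤ η n := fun n t ht => by
    have := (hpe n).2 t ht y₀ hy₀
    simpa only [hη n, complexVariance, hx_mean, sub_zero] using this
  have hη0 : ∀ n, 0 ≤ η n := fun n => (abs_nonneg _).trans (hlam n y hy)
  have hf := continuousOn_of_abs_cell_sub_le hη_lim hlam
  have hσ := continuousOn_of_abs_cell_sub_le
    (a := fun n k => ∫ ω, ‖x n k (cell n y₀) ω‖ ^ 2 ∂P) hη_lim hvar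
  -- The fibre of `f` over `f y` misses `y₀`, so (d) is only used off the diagonal.
  have hσc : ∀ t ∈ Set.Icc (0 : ℝ) 1, f t = f y → σ t y₀ ^ 2 = τ (f y₀) (f y) := by
    intro t ht htc
    rw [hτ t ht y₀ hy₀ (by rintro rfl; exact hne htc.symm), htc, hτ_symm]
  -- consequences of the choice of the window size
  have hsmall : ∀ (b : ℕ+ → ℝ) (k : ℕ), k ≤ 8 → (∀ n, 0 ≤ b n) →
      (∀ n, b n ≤ max (Real.sqrt n * ε n) (max (η n) (Real.sqrt n)⁻¹)) →
      Tendsto (fun n => b n / α n ^ k) atTop (𝓝 0) := by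
    intro b k hk hb0 hb
    have hlim : Tendsto (fun n : ℕ+ =>
        max (Real.sqrt n * ε n) (max (η n) (Real.sqrt n)⁻¹) / α n ^ 8) atTop (𝓝 0) := hα
    refine tendsto_of_tendsto_of_tendsto_of_le_of_le' tendsto_const_nhds hlim
      (Eventually.of_forall fun n => div_nonneg (hb0 n) (pow_nonneg (hα_pos n).le _)) ?_
    filter_upwards [hα_lim.eventually (gt_mem_nhds one_pos)] with n hn
    exact div_le_div₀ ((hb0 n).trans (hb n)) (hb n) (pow_pos (hα_pos n) 8)
      (pow_le_pow_of_le_one (hα_pos n).le hn.le hk)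
  -- Radii will change by `α²`, costing a Lipschitz constant `α⁻²`. With Hilbert-Schmidt norm at
  -- most `α⁵` and squared column norm at most `n / α`, the error is `n α²`, negligible against `2 n
  -- α`.
  have hεα := hsmall (fun n => Real.sqrt n * ε n) 5 (by norm_num)
    (fun n => mul_nonneg (Real.sqrt_nonneg _) (hε n).le) (fun n => le_max_left _ _)
  have hηα := hsmall η 1 (by norm_num) hη0
    (fun n => (le_max_left _ _).trans (le_max_right _ _))
  have hnα := hsmall (fun n => (Real.sqrt n)⁻¹) 1 (by norm_num) (fun n => by positivity)
    (fun n => (le_max_right _ _).trans (le_max_right _ _))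
  simp only [pow_one] at hηα hnα
  -- windows of the diagonal matrix
  have hradius : ∀ a : ℝ, Tendsto (fun n => (α n + a * α n ^ 2) / α n) atTop (𝓝 1) := by
    intro a
    have : Tendsto (fun n => 1 + a * α n) atTop (𝓝 1) := by
      simpa using (hα_lim.const_mul a).const_add 1
    refine this.congr fun n => ?_
    have := (hα_pos n).ne'
    field_simp
  have hradius0 : ∀ a : ℝ, Tendsto (fun n => α n + a * α n ^ 2) atTop (𝓝 0) := fun a => by
    simpa using hα_lim.add ((hα_lim.pow 2).const_mul a)
  have hcard := fun a => tendsto_card_window_div hf hlam hα_pos hα_lim hηα (hradius a) hρ_lim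
  have hsum := fun a => tendsto_probFilter_sum_norm_sq_div hx_meas hx_herm hx_indep hC hnα
    (fun n => cell n y₀) _ (tendsto_sum_window_div hρ_pos hf hσ hσc hlam hvar hη_lim
      (hradius0 a) hα_pos (hcard a))
  -- the size of the perturbation
  have hHS := tendsto_probFilter_sum_sum_norm_sq hx_meas hC 5 hεα
  have hcol := tendsto_probFilter_sum_norm_sq hx_meas hC hα_pos hα_lim (fun n => cell n y₀)
  have hgood : ∀ᶠ z : ℕ+ × Ω in probFilter P,
      (∑ j, ∑ k, (μ z.1 z.2 j - lam z.1 k) ^ 2 *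
        ‖inner ℂ (u z.1 z.2 j) (EuclideanSpace.basisFun (Fin z.1) ℂ k)‖ ^ 2 ≤
          (α z.1 ^ 5) ^ 2) ∧
      ‖(WithLp.toLp 2 fun l => x z.1 l (cell z.1 y₀) z.2 : EuclideanSpace ℂ (Fin z.1))‖ ^ 2 ≤
        z.1 / α z.1 := by
    filter_upwards [hHS.eventually (gt_mem_nhds one_pos), hcol.eventually (gt_mem_nhds one_pos)]
      with z hz1 hz2
    have hαz := hα_pos z.1
    have hn : (0 : ℝ) < (z.1 : ℕ) := Nat.cast_pos.2 z.1.pos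
    constructor
    · rw [(hu z.1 z.2).sum_sub_sq_mul_norm_inner_sq (fun i j => hx_herm z.1 i j z.2)]
      rw [div_lt_one (by positivity)] at hz1
      exact hz1.le
    · refine (norm_sq_toLp (x := fun i j => x z.1 i j z.2) (cell z.1 y₀)).trans_le ?_
      rw [le_div_iff₀ hαz]
      rw [div_mul_eq_mul_div, div_lt_one hn] at hz2
      linarith
  have hα_fst : Tendsto (fun z : ℕ+ × Ω => α z.1) (probFilter P) (𝓝 0) :=
    hα_lim.comp tendsto_fst_probFilter
  -- windows of the perturbed matrix
  have hN : Tendsto (fun z : ℕ+ × Ω => ((window (μ z.1 z.2) (f y) (α z.1)).card : ℝ) /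
      (2 * z.1 * α z.1)) (probFilter P) (𝓝 (ρ (f y))) := by
    have hl := ((hcard (-1)).comp (tendsto_fst_probFilter (P := P))).sub
      ((hα_fst.pow 2).div_const 2)
    have hr := ((hcard 1).comp (tendsto_fst_probFilter (P := P))).add
      ((hα_fst.pow 2).div_const 2)
    simp only [ne_eq, OfNat.ofNat_ne_zero, not_false_eq_true, zero_pow, zero_div, sub_zero,
      add_zero] at hl hr
    have herr : ∀ n : ℕ+, (n : ℝ) * ((α n ^ 2)⁻¹ * α n ^ 5) = α n ^ 2 / 2 * (2 * n * α n) := by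
      intro n
      have := (hα_pos n).ne'
      field_simp
    refine tendsto_of_tendsto_of_tendsto_of_le_of_le' hl hr ?_ ?_
    · filter_upwards [hgood] with z hz
      have hαz := hα_pos z.1
      have hn : (0 : ℝ) < (z.1 : ℕ) := Nat.cast_pos.2 z.1.pos
      have h := card_window_le (pow_nonneg hαz.le 5)
        (sum_sq_mul_norm_inner_sq_symm.trans_le hz.1) (f y)
        (show α z.1 + -1 * α z.1 ^ 2 < α z.1 by nlinarith)
      have hne0 : 2 * (z.1 : ℝ) * α z.1 ≠ 0 := by positivity
      simp only [Function.comp]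
      rw [sub_le_iff_le_add, div_le_iff₀ (by positivity)]
      rw [show α z.1 - (α z.1 + -1 * α z.1 ^ 2) = α z.1 ^ 2 by ring, herr] at h
      rwa [add_mul, div_mul_cancel₀ _ hne0]
    · filter_upwards [hgood] with z hz
      have hαz := hα_pos z.1
      have hn : (0 : ℝ) < (z.1 : ℕ) := Nat.cast_pos.2 z.1.pos
      have h := card_window_le (pow_nonneg hαz.le 5) hz.1 (f y)
        (show α z.1 < α z.1 + 1 * α z.1 ^ 2 by nlinarith)
      have hne0 : 2 * (z.1 : ℝ) * α z.1 ≠ 0 := by positivity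
      simp only [Function.comp]
      rw [div_le_iff₀ (by positivity)]
      rw [show α z.1 + 1 * α z.1 ^ 2 - α z.1 = α z.1 ^ 2 by ring, herr] at h
      rwa [add_mul, div_mul_cancel₀ _ hne0]
  have hQ : Tendsto (fun z : ℕ+ × Ω => (∑ j ∈ window (μ z.1 z.2) (f y) (α z.1),
      ‖inner ℂ (u z.1 z.2 j) (WithLp.toLp 2 fun l => x z.1 l (cell z.1 y₀) z.2)‖ ^ 2) /
      (2 * z.1 * α z.1)) (probFilter P) (𝓝 (ρ (f y) * τ (f y₀) (f y))) := by
    have hl := (hsum (-1)).sub (hα_fst.div_const 2)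
    have hr := (hsum 1).add (hα_fst.div_const 2)
    simp only [zero_div, sub_zero, add_zero] at hl hr
    have herr : ∀ (a v : ℝ) (n : ℕ+), v ≤ n / α n →
        a + (α n ^ 2)⁻¹ * α n ^ 5 * v ≤ a + α n / 2 * (2 * n * α n) := by
      intro a v n hv
      have hαz := hα_pos n
      refine add_le_add le_rfl ((mul_le_mul_of_nonneg_left hv (by positivity)).trans
        (le_of_eq ?_))
      field_simp
    refine tendsto_of_tendsto_of_tendsto_of_le_of_le' hl hr ?_ ?_
    · filter_upwards [hgood] with z hz
      have hαz := hα_pos z.1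
      have hn : (0 : ℝ) < (z.1 : ℕ) := Nat.cast_pos.2 z.1.pos
      have h := sum_window_norm_inner_sq_le (pow_nonneg hαz.le 5)
        (sum_sq_mul_norm_inner_sq_symm.trans_le hz.1) (f y)
        (show α z.1 + -1 * α z.1 ^ 2 < α z.1 by nlinarith)
        (WithLp.toLp 2 fun l => x z.1 l (cell z.1 y₀) z.2)
      rw [show α z.1 - (α z.1 + -1 * α z.1 ^ 2) = α z.1 ^ 2 by ring] at h
      have h' := h.trans (herr _ _ z.1 hz.2)
      have hne0 : 2 * (z.1 : ℝ) * α z.1 ≠ 0 := by positivity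
      rw [sub_le_iff_le_add, div_le_iff₀ (by positivity), add_mul, div_mul_cancel₀ _ hne0]
      simpa only [norm_inner_basisFun_toLp] using h'
    · filter_upwards [hgood] with z hz
      have hαz := hα_pos z.1
      have hn : (0 : ℝ) < (z.1 : ℕ) := Nat.cast_pos.2 z.1.pos
      have h := sum_window_norm_inner_sq_le (pow_nonneg hαz.le 5) hz.1 (f y)
        (show α z.1 < α z.1 + 1 * α z.1 ^ 2 by nlinarith)
        (WithLp.toLp 2 fun l => x z.1 l (cell z.1 y₀) z.2)
      rw [show α z.1 + 1 * α z.1 ^ 2 - α z.1 = α z.1 ^ 2 by ring] at h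
      have h' := h.trans (herr _ _ z.1 hz.2)
      have hne0 : 2 * (z.1 : ℝ) * α z.1 ≠ 0 := by positivity
      rw [div_le_iff₀ (by positivity), add_mul, div_mul_cancel₀ _ hne0]
      simpa only [norm_inner_basisFun_toLp] using h'
  have hR : Tendsto (fun z : ℕ+ × Ω => (∑ j ∈ window (μ z.1 z.2) (f y) (α z.1),
      ‖inner ℂ (u z.1 z.2 j) (WithLp.toLp 2 fun l => x z.1 l (cell z.1 y₀) z.2)‖ ^ 2) /
      (window (μ z.1 z.2) (f y) (α z.1)).card) (probFilter P) (𝓝 (τ (f y₀) (f y))) := by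
    -- The normalization `2 n α` cancels; positivity of the density makes the limiting denominator
    -- nonzero.
    have := hQ.div hN hρ_pos.ne'
    rw [mul_div_cancel_left₀ _ hρ_pos.ne'] at this
    refine this.congr fun z => ?_
    have hαz := hα_pos z.1
    have hn : (0 : ℝ) < (z.1 : ℕ) := Nat.cast_pos.2 z.1.pos
    exact div_div_div_cancel_right₀ (by positivity) _ _
  -- the factors `(μ j - lam i) ^ 2` are asymptotically constant
  have hD : 0 < |f y - f y₀| := abs_pos.2 (sub_ne_zero.2 hne)
  have hαη : Tendsto (fun z : ℕ+ × Ω => α z.1 + η z.1) (probFilter P) (𝓝 0) := by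
    simpa using hα_fst.add (hη_lim.comp (tendsto_fst_probFilter (P := P)))
  -- Every denominator `|μ_j - λ_i|` lies within `α + η` of `|f y - f y₀|`, so these two quotients
  -- squeeze the averaged overlap.
  have hl := hR.div ((hαη.const_add |f y - f y₀|).pow 2) (by simpa using hD.ne')
  have hr := hR.div ((hαη.const_sub |f y - f y₀|).pow 2) (by simpa using hD.ne')
  rw [add_zero, sq_abs] at hl
  rw [sub_zero, sq_abs] at hr
  refine tendstoInMeasure_of_tendsto_probFilter ?_
  have hov : ∀ z : ℕ+ × Ω, α z.1 + η z.1 < |f y - f y₀| →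
      averagedOverlap (u z.1 z.2) (μ z.1 z.2) (ε z.1) (f y) (α z.1) (cell z.1 y₀) =
        (∑ j ∈ window (μ z.1 z.2) (f y) (α z.1),
          ‖inner ℂ (u z.1 z.2 j) (WithLp.toLp 2 fun l => x z.1 l (cell z.1 y₀) z.2)‖ ^ 2 /
            (μ z.1 z.2 j - lam z.1 (cell z.1 y₀)) ^ 2) /
          (window (μ z.1 z.2) (f y) (α z.1)).card ∧
      ∀ j ∈ window (μ z.1 z.2) (f y) (α z.1),
        |f y - f y₀| - (α z.1 + η z.1) ≤ |μ z.1 z.2 j - lam z.1 (cell z.1 y₀)| ∧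
        |μ z.1 z.2 j - lam z.1 (cell z.1 y₀)| ≤ |f y - f y₀| + (α z.1 + η z.1) := by
    intro z hz
    have hdist : ∀ j ∈ window (μ z.1 z.2) (f y) (α z.1),
        |f y - f y₀| - (α z.1 + η z.1) ≤ |μ z.1 z.2 j - lam z.1 (cell z.1 y₀)| ∧
        |μ z.1 z.2 j - lam z.1 (cell z.1 y₀)| ≤ |f y - f y₀| + (α z.1 + η z.1) := by
      intro j hj
      have h1 : |μ z.1 z.2 j - f y| < α z.1 := by simpa [window] using hj
      have h2 := hlam z.1 y₀ hy₀
      have h3 := abs_abs_sub_abs_le_abs_sub (μ z.1 z.2 j - lam z.1 (cell z.1 y₀)) (f y - f y₀)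
      have h4 := abs_sub (μ z.1 z.2 j - f y) (lam z.1 (cell z.1 y₀) - f y₀)
      rw [show μ z.1 z.2 j - f y - (lam z.1 (cell z.1 y₀) - f y₀) =
        μ z.1 z.2 j - lam z.1 (cell z.1 y₀) - (f y - f y₀) by ring] at h4
      have h5 := abs_le.1 (h3.trans (h4.trans (add_le_add h1.le h2)))
      exact ⟨by linarith [h5.1], by linarith [h5.2]⟩
    refine ⟨?_, hdist⟩
    rw [averagedOverlap, div_mul_eq_mul_div, Finset.mul_sum]
    congr 1
    refine Finset.sum_congr rfl fun j hj => ?_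
    have h0 : μ z.1 z.2 j - lam z.1 (cell z.1 y₀) ≠ 0 :=
      abs_pos.1 (lt_of_lt_of_le (by linarith) (hdist j hj).1)
    have h := (hu z.1 z.2).sub_sq_mul_norm_inner_sq (fun i j => hx_herm z.1 i j z.2) j
      (cell z.1 y₀)
    have hn : ((z.1 : ℕ) : ℝ) ≠ 0 := Nat.cast_ne_zero.2 z.1.ne_zero
    have hεz := (hε z.1).ne'
    rw [eq_div_iff (pow_ne_zero 2 h0), mul_assoc, mul_comm (‖_‖ ^ 2) ((_ - _) ^ 2), h]
    field_simp
  have hlt := hαη.eventually (gt_mem_nhds hD)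
  refine tendsto_of_tendsto_of_tendsto_of_le_of_le' hl hr ?_ ?_
  · filter_upwards [hlt] with z hz
    obtain ⟨heq, hdist⟩ := hov z hz
    rw [heq, Pi.div_apply, div_right_comm, Finset.sum_div]
    refine div_le_div_of_nonneg_right (Finset.sum_le_sum fun j hj => ?_) (Nat.cast_nonneg (α := ℝ) _)
    have hpos := lt_of_lt_of_le (sub_pos.2 hz) (hdist j hj).1
    rw [← sq_abs (μ z.1 z.2 j - _)]
    exact div_le_div_of_nonneg_left (sq_nonneg _) (by positivity)
      (pow_le_pow_left₀ hpos.le (hdist j hj).2 2)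
  · filter_upwards [hlt] with z hz
    obtain ⟨heq, hdist⟩ := hov z hz
    rw [heq, Pi.div_apply, div_right_comm,
      Finset.sum_div _ _ ((|f y - f y₀| - (α z.1 + η z.1)) ^ 2)]
    refine div_le_div_of_nonneg_right (Finset.sum_le_sum fun j hj => ?_) (Nat.cast_nonneg (α := ℝ) _)
    have hpos := sub_pos.2 hz
    rw [← sq_abs (μ z.1 z.2 j - _)]
    exact div_le_div_of_nonneg_left (sq_nonneg _) (by positivity)
      (pow_le_pow_left₀ hpos.le (hdist j hj).1 2)
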